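/- Let $k$ be either a $p$-adic field, i.e. a finite extension of $\mathbb{Q}_p$ for some prime $p$ (with its $p$-adic topology), or the field $\mathbb{R}$ of real numbers (with its usual topology). For $n\geq 1$ let $\mathrm{Sym}_n(k)$ be the space of symmetric $n\times n$ matrices over $k$, with the topology induced from that of $k$; a matrix $A\in \mathrm{Sym}_n(k)$ is identified with the quadratic form $x\mapsto x^{t}Ax$ in $n$ variables. For an integer $m\geq 0$, a quadratic form $T$ over $k$ is said to split $m$ hyperbolic planes if it is isometric to an orthogonal sum $$\underbrace{\langle -1,1\rangle\perp\cdots\perp\langle -1,1\rangle}_{m}\perp T'$$ for some (possibly degenerate, possibly zero-dimensional) quadratic form $T'$ over $k$. A quadratic form in $2n$ variables is said to be purely hyperbolic if it splits $n$ hyperbolic planes. Then: 1. For every integer $n\geq 1$, the set of purely hyperbolic quadratic forms in $2n$ variables is open in $\mathrm{Sym}_{2n}(k)$. 2. For all integers $n\geq 1$ and $m\geq 0$, the set of quadratic forms in $n$ variables that split $m$ hyperbolic planes is open in $\mathrm{Sym}_n(k)$. -/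

import Mathlib

/-- A `p`-adic field: a finite extension of `ℚ_[p]` for some prime `p` (`p = 2` is allowed), with its
`p`-adic topology, i.e. the topology of a finite-dimensional `ℚ_[p]`-vector space. -/
def IsPadicField (k : Type*) [Field k] [TopologicalSpace k] : Prop :=
  ∃ (p : ℕ) (_ : Fact p.Prime) (_ : Algebra ℚ_[p] k),
    FiniteDimensional ℚ_[p] k ∧ IsModuleTopology ℚ_[p] k

/-- The field of real numbers, up to isomorphism of topological fields. -/
def IsRealField (k : Type*) [Field k] [TopologicalSpace k] : Prop :=
  ∃ e : k ≃+* ℝ, IsHomeomorph e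

/-- `Sym_n(k)`: symmetric `n × n` matrices, with the subspace topology whenever `k` has a
topology. -/
abbrev SymMatrix (n : ℕ) (k : Type*) : Type _ :=
  {A : Matrix (Fin n) (Fin n) k // A.IsSymm}

/-- The quadratic form `x ↦ xᵀ A x` in `n` variables given by a symmetric matrix `A`. -/
def SymMatrix.form {n : ℕ} {k : Type*} [Field k] (A : SymMatrix n k) :
    QuadraticForm k (Fin n → k) :=
  A.1.toQuadraticForm'

/-- The hyperbolic plane `⟨-1, 1⟩`, that is `(x, y) ↦ -x² + y²`. -/
def hyperbolicPlane (k : Type*) [Field k] : QuadraticForm k (Fin 2 → k) :=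
  QuadraticMap.weightedSumSquares k (![-1, 1] : Fin 2 → k)

/-- `T` splits `m` hyperbolic planes: `T ≅ ⟨-1, 1⟩ ⊥ ⋯ ⊥ ⟨-1, 1⟩ ⊥ T'` with `m` copies of
`⟨-1, 1⟩`, for some quadratic form `T'` in finitely many variables (possibly none). -/
def SplitsHyperbolicPlanes {k V : Type*} [Field k] [AddCommGroup V] [Module k V]
    (T : QuadraticForm k V) (m : ℕ) : Prop :=
  ∃ (r : ℕ) (T' : QuadraticForm k (Fin r → k)),
    QuadraticMap.Equivalent T
      ((QuadraticMap.pi fun _ : Fin m => hyperbolicPlane k).prod T')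

/-- A quadratic form in `2n` variables is purely hyperbolic if it splits `n` hyperbolic planes. -/
def IsPurelyHyperbolic {k : Type*} [Field k] {n : ℕ}
    (T : QuadraticForm k (Fin (2 * n) → k)) : Prop :=
  SplitsHyperbolicPlanes T n

/-!
The form `T` splits off a nondegenerate form `Q` if and only if `Q` embeds isometrically into `T`,
since the image of `Q` has an orthogonal complement. If `2` is invertible, we may take `Q` to be
diagonal, with Gram matrix `D`, and the condition on the Gram matrix `A` of `T` becomes the
solvability of `P * A * Pᵀ = D`. If `P` is a solution for `A` and `A'` is close to `A`, then
`P * A' * Pᵀ` is close to `D`, so it suffices that every symmetric matrix close to `D` is congruent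
to `D`. Taking Schur complements, this reduces to `1 × 1` matrices, where it says that elements of
the field close to `1` are squares.
-/

open Filter Topology

/-- A topological field of characteristic different from `2` in which every element close to `1`
is a square: the class of fields over which the openness results below hold. -/
class IsLocallySquareField (k : Type*) [Field k] [TopologicalSpace k] : Prop
    extends IsTopologicalDivisionRing k, T1Space k, NeZero (2 : k) where
  eventually_isSquare : ∀ᶠ x in 𝓝 (1 : k), IsSquare x

namespace IsLocallySquareField

theorem of_completeSpace (K : Type*) [NontriviallyNormedField K] [CompleteSpace K]
    [NeZero (2 : K)] : IsLocallySquareField K where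
  eventually_isSquare := by
    have hderiv : HasStrictDerivAt (fun x : K => x ^ 2) 2 1 := by
      simpa using hasStrictDerivAt_pow 2 (1 : K)
    have hmap : map (fun x : K => x ^ 2) (𝓝 1) = 𝓝 1 := by
      simpa using hderiv.map_nhds_eq two_ne_zero
    rw [← hmap, eventually_map]
    exact .of_forall fun x => IsSquare.sq x

theorem of_ringEquiv {k K : Type*} [Field k] [TopologicalSpace k] [Field K] [TopologicalSpace K]
    [IsLocallySquareField K] (e : k ≃+* K) (he : IsInducing e) : IsLocallySquareField k where
  __ := he.continuousAdd e
  __ := he.continuousMul e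
  __ := he.continuousNeg (map_neg e)
  __ := (IsEmbedding.mk he e.injective).t1Space
  continuousAt_inv₀ x hx := by
    rw [he.continuousAt_iff]
    simpa only [Function.comp_def, map_inv₀] using
      he.continuous.continuousAt.fun_inv₀ ((map_ne_zero e).2 hx)
  out h := two_ne_zero (α := K) (by rw [← map_ofNat e 2, h, map_zero])
  eventually_isSquare := by
    rw [he.nhds_eq_comap, map_one]
    filter_upwards [tendsto_comap.eventually eventually_isSquare] with x hx
    simpa using hx.map e.symm

end IsLocallySquareField

theorem IsPadicField.isLocallySquareField {k : Type*} [Field k] [τ : TopologicalSpace k]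
    (hk : IsPadicField k) : IsLocallySquareField k := by
  obtain ⟨p, _, _, _, hτ⟩ := hk
  have : CharZero k := charZero_of_injective_algebraMap (algebraMap ℚ_[p] k).injective
  -- Both `τ` and the topology of the spectral norm are the `ℚ_[p]`-module topology of `k`.
  rw [hτ.eq_moduleTopology']
  clear hτ τ
  let : NontriviallyNormedField k := spectralNorm.nontriviallyNormedField ℚ_[p] k
  let : NormedSpace ℚ_[p] k := spectralNorm.normedSpace ℚ_[p] k
  have : CompleteSpace k := FiniteDimensional.complete ℚ_[p] k
  have : IsModuleTopology ℚ_[p] k := isModuleTopologyOfFiniteDimensional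
  rw [← eq_moduleTopology ℚ_[p] k]
  exact .of_completeSpace k

theorem IsRealField.isLocallySquareField {k : Type*} [Field k] [TopologicalSpace k]
    (hk : IsRealField k) : IsLocallySquareField k := by
  obtain ⟨e, he⟩ := hk
  have : IsLocallySquareField ℝ := .of_completeSpace ℝ
  exact .of_ringEquiv e he.isInducing

section Congruence

open Matrix

variable {ι κ : Type*} [Fintype ι] [Fintype κ]

section CommRing

variable {R : Type*} [CommRing R]

theorem exists_mul_fromBlocks_mul_transpose [DecidableEq ι] {A : Matrix ι ι R}
    (hA : A.IsSymm) (hAunit : IsUnit A.det) (B : Matrix ι κ R) (C : Matrix κ κ R)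
    (P : Matrix ι ι R) (Q : Matrix κ κ R) :
    ∃ S, S * fromBlocks A B Bᵀ C * Sᵀ =
      fromBlocks (P * A * Pᵀ) 0 0 (Q * (C - Bᵀ * A⁻¹ * B) * Qᵀ) := by
  refine ⟨fromBlocks P 0 (-(Q * Bᵀ * A⁻¹)) Q, ?_⟩
  simp [fromBlocks_multiply, fromBlocks_transpose, Matrix.mul_assoc, transpose_nonsing_inv, hA.eq,
    Matrix.mul_add, Matrix.add_mul, nonsing_inv_mul _ hAunit,
    mul_nonsing_inv_cancel_left _ _ hAunit, sub_eq_neg_add]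

variable [TopologicalSpace R]

/-- A matrix `D` is congruence-stable if every symmetric matrix close to `D` is congruent to `D`,
the congruence being `M ↦ P * M * Pᵀ` (for invertible `D`, such a `P` is invertible). -/
def IsCongruenceStable (D : Matrix ι ι R) : Prop :=
  ∀ᶠ M in 𝓝 D, M.IsSymm → ∃ P : Matrix ι ι R, P * M * Pᵀ = D

theorem IsCongruenceStable.submatrix_equiv {D : Matrix ι ι R} (hD : IsCongruenceStable D)
    (e : κ ≃ ι) : IsCongruenceStable (D.submatrix e e) := by
  have htendsto : Tendsto (fun M : Matrix κ κ R => M.submatrix e.symm e.symm)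
      (𝓝 (D.submatrix e e)) (𝓝 D) := by
    simpa using (continuous_id.matrix_submatrix e.symm e.symm).tendsto (D.submatrix e e)
  filter_upwards [htendsto.eventually hD] with M hM hMsymm
  obtain ⟨P, hP⟩ := hM (hMsymm.submatrix e.symm)
  refine ⟨P.submatrix e e, ?_⟩
  rw [transpose_submatrix, ← hP, ← submatrix_mul_equiv _ _ e e e, ← submatrix_mul_equiv _ _ e e e,
    submatrix_submatrix, e.symm_comp_self, submatrix_id_id]

theorem isOpen_setOf_exists_mul_mul_transpose_eq [IsTopologicalRing R] {D : Matrix ι ι R}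
    (hD : IsCongruenceStable D) :
    IsOpen {A : {A : Matrix κ κ R // A.IsSymm} | ∃ P : Matrix ι κ R, P * A.1 * Pᵀ = D} := by
  rw [isOpen_iff_eventually]
  rintro A ⟨P, hP⟩
  have htendsto : Tendsto (fun A' : {A : Matrix κ κ R // A.IsSymm} => P * A'.1 * Pᵀ)
      (𝓝 A) (𝓝 D) :=
    ((continuous_const.matrix_mul continuous_subtype_val).matrix_mul
      continuous_const).tendsto' _ _ hP
  filter_upwards [htendsto.eventually hD] with A' hA'
  obtain ⟨Q, hQ⟩ := hA' (by simp [Matrix.IsSymm, Matrix.mul_assoc, A'.2.eq])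
  exact ⟨Q * P, by simpa [Matrix.mul_assoc] using hQ⟩

end CommRing

section Field

variable {k : Type*} [Field k] [TopologicalSpace k]

theorem continuousAt_nonsing_inv [IsTopologicalDivisionRing k] [DecidableEq ι] {A : Matrix ι ι k}
    (hA : A.det ≠ 0) : ContinuousAt Inv.inv A :=
  continuousAt_matrix_inv A (by simpa only [Ring.inverse_eq_inv'] using continuousAt_inv₀ hA)

theorem IsCongruenceStable.fromBlocks [IsTopologicalDivisionRing k] [T1Space k] [DecidableEq ι]
    {D : Matrix ι ι k} {E : Matrix κ κ k} (hD : IsCongruenceStable D) (hDdet : D.det ≠ 0)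
    (hE : IsCongruenceStable E) : IsCongruenceStable (fromBlocks D 0 0 E) := by
  set F : Matrix (ι ⊕ κ) (ι ⊕ κ) k := Matrix.fromBlocks D 0 0 E
  have hA : Tendsto (fun M => M.toBlocks₁₁) (𝓝 F) (𝓝 D) :=
    (continuous_id.matrix_submatrix Sum.inl Sum.inl).tendsto' F D rfl
  have hB : Tendsto (fun M => M.toBlocks₁₂) (𝓝 F) (𝓝 0) :=
    (continuous_id.matrix_submatrix Sum.inl Sum.inr).tendsto' F 0 rfl
  have hC : Tendsto (fun M => M.toBlocks₂₂) (𝓝 F) (𝓝 E) :=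
    (continuous_id.matrix_submatrix Sum.inr Sum.inr).tendsto' F E rfl
  have hschur : Tendsto
      (fun M => M.toBlocks₂₂ - M.toBlocks₁₂ᵀ * M.toBlocks₁₁⁻¹ * M.toBlocks₁₂) (𝓝 F) (𝓝 E) := by
    have hinv : Tendsto (fun M => M.toBlocks₁₁⁻¹) (𝓝 F) (𝓝 D⁻¹) :=
      (continuousAt_nonsing_inv hDdet).tendsto.comp hA
    have hBt : Tendsto (fun M => M.toBlocks₁₂ᵀ) (𝓝 F) (𝓝 0) :=
      (continuous_id.matrix_transpose.tendsto' 0 0 rfl).comp hB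
    have hmul : Continuous fun X : Matrix κ ι k × Matrix ι ι k × Matrix ι κ k =>
        X.1 * X.2.1 * X.2.2 := by fun_prop
    simpa using hC.sub ((hmul.tendsto (0, D⁻¹, 0)).comp (hBt.prodMk_nhds (hinv.prodMk_nhds hB)))
  have hdet : ∀ᶠ M in 𝓝 F, M.toBlocks₁₁.det ≠ 0 :=
    (continuous_id.matrix_det.continuousAt.tendsto.comp hA).eventually_ne hDdet
  filter_upwards [hA.eventually hD, hschur.eventually hE, hdet] with M hMD hME hMdet hM
  rw [← M.fromBlocks_toBlocks, isSymm_fromBlocks_iff] at hM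
  obtain ⟨hAsymm, hBC, -, hCsymm⟩ := hM
  obtain ⟨P, hP⟩ := hMD hAsymm
  obtain ⟨Q, hQ⟩ := hME <| hCsymm.sub <| by
    simp [Matrix.IsSymm, Matrix.mul_assoc, transpose_nonsing_inv, hAsymm.eq]
  rw [← M.fromBlocks_toBlocks, ← hBC]
  simpa only [hP, hQ] using exists_mul_fromBlocks_mul_transpose hAsymm hMdet.isUnit
    M.toBlocks₁₂ M.toBlocks₂₂ P Q

variable [IsLocallySquareField k]

theorem isCongruenceStable_of_unique [Unique ι] {D : Matrix ι ι k} (hD : D default default ≠ 0) :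
    IsCongruenceStable D := by
  have hentry : Tendsto (fun M : Matrix ι ι k => M default default) (𝓝 D)
      (𝓝 (D default default)) := (continuous_id.matrix_elem _ _).tendsto D
  have hratio : Tendsto (fun M : Matrix ι ι k => D default default / M default default) (𝓝 D)
      (𝓝 1) := by
    simpa [div_self hD, Pi.div_def] using
      (tendsto_const_nhds (x := D default default)).div hentry hD
  filter_upwards [hentry.eventually_ne hD,
    hratio.eventually IsLocallySquareField.eventually_isSquare] with M hM ⟨t, ht⟩ _
  refine ⟨of fun _ _ => t, ?_⟩
  ext i j
  have hscale : t * M default default * t = D default default := by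
    rw [mul_right_comm, ← ht, div_mul_cancel₀ _ hM]
  simpa [Matrix.mul_apply, Subsingleton.elim _ (default : ι)] using hscale

theorem isCongruenceStable_diagonal [DecidableEq ι] {d : ι → k} (hd : ∀ i, d i ≠ 0) :
    IsCongruenceStable (diagonal d) := by
  refine Finite.induction_empty_option (P := fun ι => ∀ [Fintype ι] [DecidableEq ι] {d : ι → k},
    (∀ i, d i ≠ 0) → IsCongruenceStable (diagonal d)) ?equiv ?empty ?option ι hd
  case equiv =>
    intro α β e ih _ _ d hd
    have := Fintype.ofEquiv β e.symm
    classical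
    simpa [Function.comp_def] using (ih fun i => hd (e i)).submatrix_equiv e.symm
  case empty =>
    exact fun _ => .of_forall fun M _ => ⟨1, Subsingleton.elim _ _⟩
  case option =>
    intro α _ ih _ _ d hd
    classical
    have hsplit : diagonal d = (fromBlocks (diagonal fun a => d (some a)) 0 0
        (diagonal fun _ : PUnit.{1} => d none)).submatrix (Equiv.optionEquivSumPUnit α)
          (Equiv.optionEquivSumPUnit α) := by
      rw [fromBlocks_diagonal, submatrix_diagonal_equiv]
      congr 1
      ext (_ | a) <;> simp
    rw [hsplit]
    refine (IsCongruenceStable.fromBlocks (ih fun a => hd (some a)) ?_ ?_).submatrix_equiv _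
    · simp [Finset.prod_ne_zero_iff, hd]
    · exact isCongruenceStable_of_unique (by simpa using hd none)

end Field

end Congruence

section PolarBilin

open QuadraticMap

variable {R : Type*} [CommRing R]

theorem isRefl_polarBilin {V : Type*} [AddCommGroup V] [Module R V] (Q : QuadraticForm R V) :
    Q.polarBilin.IsRefl :=
  fun x y h => (polar_comm Q y x).trans h

theorem nondegenerate_polarBilin_pi {ι : Type*} [Fintype ι] {V : ι → Type*}
    [∀ i, AddCommGroup (V i)] [∀ i, Module R (V i)] {Q : ∀ i, QuadraticForm R (V i)}
    (hQ : ∀ i, (Q i).polarBilin.Nondegenerate) : (QuadraticMap.pi Q).polarBilin.Nondegenerate := by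
  classical
  refine (isRefl_polarBilin _).nondegenerate_iff_separatingLeft.2 fun x hx => ?_
  ext i
  refine (hQ i).1 (x i) fun v => ?_
  have hsum : ∑ j, QuadraticMap.polar (Q j) (x j) (Pi.single i v j) = 0 := by
    simpa using hx (Pi.single i v)
  rwa [Finset.sum_eq_single i (by simp +contextual) (by simp), Pi.single_eq_same] at hsum

end PolarBilin

section Isometry

open QuadraticMap LinearMap LinearMap.BilinForm

variable {k V W : Type*} [Field k] [AddCommGroup V] [Module k V] [AddCommGroup W] [Module k W]

theorem equivalent_prod_of_isometry [FiniteDimensional k V] {Q : QuadraticForm k W}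
    {T : QuadraticForm k V} (hQ : Q.polarBilin.Nondegenerate) (f : Q →qᵢ T) :
    T.Equivalent
      (Q.prod (T.comp (BilinForm.orthogonal T.polarBilin f.toLinearMap.range).subtype)) := by
  have hf (x y : W) : T.polarBilin (f x) (f y) = Q.polarBilin x y := by
    simp only [polarBilin_apply_apply, QuadraticMap.polar, f.map_app, ← map_add]
  have hinj : Function.Injective f.toLinearMap :=
    (injective_iff_map_eq_zero _).2 fun x (hx : f x = 0) => hQ.1 x fun y => by
      rw [← hf, hx, map_zero, LinearMap.zero_apply]
  have hrange : (BilinForm.restrict T.polarBilin f.toLinearMap.range).Nondegenerate := by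
    have hrefl : (BilinForm.restrict T.polarBilin f.toLinearMap.range).IsRefl :=
      fun x y => isRefl_polarBilin T x y
    refine hrefl.nondegenerate_iff_separatingLeft.2 ?_
    rintro ⟨_, x, rfl⟩ hx
    have hx₀ : x = 0 := hQ.1 x fun y => (hf x y).symm.trans (hx ⟨f y, y, rfl⟩)
    simp [hx₀]
  have hcompl := isCompl_orthogonal_of_restrict_nondegenerate (isRefl_polarBilin T) hrange
  refine ⟨.symm ⟨((LinearEquiv.ofInjective f.toLinearMap hinj).prodCongr (.refl k _)).trans
    (Submodule.prodEquivOfIsCompl _ _ hcompl), fun ⟨x, y⟩ => ?_⟩⟩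
  have hxy : QuadraticMap.polar T (f x) y = 0 := y.2 _ ⟨x, rfl⟩
  simp [QuadraticMap.map_add T (f x), hxy]

theorem exists_equivalent_prod_iff_nonempty_isometry [FiniteDimensional k V]
    {Q : QuadraticForm k W} {T : QuadraticForm k V} (hQ : Q.polarBilin.Nondegenerate) :
    (∃ (r : ℕ) (T' : QuadraticForm k (Fin r → k)), T.Equivalent (Q.prod T')) ↔
      Nonempty (Q →qᵢ T) := by
  constructor
  · rintro ⟨r, T', ⟨e⟩⟩
    exact ⟨e.symm.toIsometry.comp (QuadraticMap.Isometry.inl Q T')⟩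
  · rintro ⟨f⟩
    obtain ⟨e⟩ := equivalent_prod_of_isometry hQ f
    exact ⟨_, _, ⟨e.trans <| (QuadraticMap.IsometryEquiv.refl Q).prod
      (isometryEquivBasisRepr _ (Module.finBasis k _))⟩⟩

end Isometry

section GramMatrix

open Matrix QuadraticMap

variable {R ι κ : Type*} [CommRing R] [Invertible (2 : R)] [Fintype ι] [DecidableEq ι] [Fintype κ]
  [DecidableEq κ]

theorem toMatrix'_toQuadraticForm' {A : Matrix ι ι R} (hA : A.IsSymm) :
    A.toQuadraticForm'.toMatrix' = A := by
  have hsymm (x y : ι → R) : A.toLinearMap₂' R x y = A.toLinearMap₂' R y x := by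
    rw [toLinearMap₂'_apply', toLinearMap₂'_apply', dotProduct_comm, ← vecMul_transpose,
      hA.eq, ← dotProduct_mulVec]
  rw [QuadraticForm.toMatrix', Matrix.toQuadraticForm', associated_left_inverse R hsymm,
    LinearMap.toMatrix'_toLinearMap₂']

theorem toMatrix'_injective :
    Function.Injective (QuadraticForm.toMatrix' : QuadraticForm R (ι → R) → Matrix ι ι R) := by
  intro Q Q' h
  have h' : associated Q = associated Q' := (LinearMap.toMatrix₂' R).injective h
  rw [← toQuadraticMap_associated R Q, h', toQuadraticMap_associated]

theorem nonempty_isometry_iff_exists_mul_mul_transpose_eq {Q : QuadraticForm R (ι → R)}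
    {T : QuadraticForm R (κ → R)} :
    Nonempty (Q →qᵢ T) ↔ ∃ P : Matrix ι κ R, P * T.toMatrix' * Pᵀ = Q.toMatrix' := by
  have hcomp (f : (ι → R) →ₗ[R] κ → R) :
      QuadraticForm.toMatrix' (T.comp f) = f.toMatrix'ᵀ * T.toMatrix' * f.toMatrix' := by
    simp only [QuadraticForm.toMatrix', associated_comp, LinearMap.toMatrix₂'_compl₁₂]
  constructor
  · rintro ⟨f⟩
    have hf : T.comp f.toLinearMap = Q := QuadraticMap.ext f.map_app
    exact ⟨f.toLinearMap.toMatrix'ᵀ, by rw [transpose_transpose, ← hcomp, hf]⟩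
  · rintro ⟨P, hP⟩
    have hf : T.comp Pᵀ.toLin' = Q := toMatrix'_injective <| by
      rw [hcomp, LinearMap.toMatrix'_toLin', transpose_transpose, hP]
    exact ⟨⟨Pᵀ.toLin', DFunLike.congr_fun hf⟩⟩

theorem toMatrix'_weightedSumSquares (d : ι → R) :
    QuadraticForm.toMatrix' (weightedSumSquares R d) = diagonal d := by
  rw [← toMatrix'_toQuadraticForm' (isSymm_diagonal d)]
  congr 1
  ext x
  simp [Matrix.toQuadraticForm', toLinearMap₂'_apply', dotProduct, mulVec_diagonal, mul_left_comm]

end GramMatrix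

theorem nondegenerate_polarBilin_hyperbolicPlane (k : Type*) [Field k] [NeZero (2 : k)] :
    (hyperbolicPlane k).polarBilin.Nondegenerate := by
  let := invertibleOfNonzero (two_ne_zero (α := k))
  rw [QuadraticMap.nondegenerate_polar_iff, QuadraticMap.nondegenerate_iff_radical_eq_bot]
  have hweights : {i | (![-1, 1] : Fin 2 → k) i = 0} = ∅ := by
    ext i; fin_cases i <;> simp
  simp [hyperbolicPlane, QuadraticForm.radical_weightedSumSquares, hweights, Pi.spanSubset]

open Matrix QuadraticMap in
theorem mainTheorem12_general {k : Type*} [Field k] [TopologicalSpace k] [IsLocallySquareField k]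
    {W : Type*} [AddCommGroup W] [Module k W] [FiniteDimensional k W] {Q : QuadraticForm k W}
    (hQ : Q.polarBilin.Nondegenerate) (n : ℕ) :
    IsOpen {A : SymMatrix n k | ∃ (r : ℕ) (T' : QuadraticForm k (Fin r → k)),
      A.form.Equivalent (Q.prod T')} := by
  let := invertibleOfNonzero (two_ne_zero (α := k))
  obtain ⟨d, ⟨e⟩⟩ := QuadraticForm.equivalent_weightedSumSquares_units_of_nondegenerate' Q
    (nondegenerate_associated_iff.2 (nondegenerate_polar_iff.1 hQ)).1
  have hsplits (A : SymMatrix n k) :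
      (∃ (r : ℕ) (T' : QuadraticForm k (Fin r → k)), A.form.Equivalent (Q.prod T')) ↔
        ∃ P : Matrix _ (Fin n) k, P * A.1 * Pᵀ = diagonal fun i => (d i : k) := by
    have hiso : Nonempty (Q →qᵢ A.form) ↔
        Nonempty (weightedSumSquares k (fun i => (d i : k)) →qᵢ A.form) :=
      ⟨fun ⟨f⟩ => ⟨f.comp e.symm.toIsometry⟩, fun ⟨f⟩ => ⟨f.comp e.toIsometry⟩⟩
    rw [exists_equivalent_prod_iff_nonempty_isometry hQ, hiso,
      nonempty_isometry_iff_exists_mul_mul_transpose_eq, toMatrix'_weightedSumSquares,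
      SymMatrix.form, toMatrix'_toQuadraticForm' A.2]
  simp only [hsplits]
  exact isOpen_setOf_exists_mul_mul_transpose_eq
    (isCongruenceStable_diagonal fun i => (d i).ne_zero)

theorem mainTheorem12 (k : Type*) [Field k] [TopologicalSpace k]
    (hk : IsPadicField k ∨ IsRealField k) :
    (∀ n : ℕ, 1 ≤ n → IsOpen {A : SymMatrix (2 * n) k | IsPurelyHyperbolic A.form}) ∧
    (∀ n m : ℕ, 1 ≤ n → IsOpen {A : SymMatrix n k | SplitsHyperbolicPlanes A.form m}) := by
  have : IsLocallySquareField k :=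
    hk.elim IsPadicField.isLocallySquareField IsRealField.isLocallySquareField
  have hopen (n m : ℕ) : IsOpen {A : SymMatrix n k | SplitsHyperbolicPlanes A.form m} :=
    mainTheorem12_general
      (nondegenerate_polarBilin_pi fun _ => nondegenerate_polarBilin_hyperbolicPlane k) n
  exact ⟨fun n _ => hopen (2 * n) n, fun n m _ => hopen n m⟩
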